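/- **Setting.** Let $n_1,n_2\ge 2$, $n=n_1+n_2$, $V=U\sqcup L$ with $U=\{v_1,\dots,v_{n_1}\}$, $L=\{v_{n_1+1},\dots,v_n\}$, let $\beta_1\ge\beta_2>0$ be real, and put $\beta(v)=\beta_1$ for $v\in U$, $\beta(v)=\beta_2$ for $v\in L$. Let $a\ge 1$ and $k=n_1+a\le n$. *Information flow graphs.* Let $s=(s_1,s_2,\dots)\in V^{\mathbb N}$ be the sequence of failed nodes and let $h=(h_j)_{j\ge1}$, $h_j:V\to[0,\infty)$, be weight functions. The graph $\mathcal X_0$ has a source $\tilde v$, the nodes of $V$ (the active nodes at time $0$), and edges of infinite weight from $\tilde v$ to each of them. $\mathcal X_j$ arises from $\mathcal X_{j-1}$ by adding a vertex $CU_j$ and a new copy of the node $s_j$, an edge of weight $h_j(u)$ to $CU_j$ from the active copy of every node $u\ne s_j$, and an edge of infinite weight from $CU_j$ to the new copy of $s_j$, which replaces the old copy as an active node. Let $\mathcal A_t$ be the set of active nodes of $\mathcal X_t$. *Capacity.* $\mathsf{cap}_h(s)$ is the infimum, over all $t\ge 0$ and all $D\subseteq\mathcal A_t$ with $|D|=k$,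 of the minimum weight of a cut in $\mathcal X_t$ separating $\tilde v$ from $D$ (the largest file size that can be retrieved at any time from any $k$ active nodes). The capacity $\mathsf{cap}(\mathcal N)=\mathsf{cap}(s)$ is the supremum of $\mathsf{cap}_h(s)$ over all $h$ with $\limsup_{l\to\infty}\frac1l\sum_{j=1}^l h_j(v)\le\beta(v)$ for every $v\in V$. *Cuts under $h^*$.* Let $h^*_j(v)=\beta(v)$ if $v\ne s_j$ and $h^*_j(s_j)=0$. For $D\subseteq\mathcal A_t$ let $C_t(D)$ be the minimum weight, under $h^*$, of a cut in $\mathcal X_t$ separating $(\{\tilde v\}\cup\bigcup_{i<t}\mathcal A_i)\setminus\mathcal A_t$ from $D$; let $C_t=\min_{|D|=k}C_t(D)$, and let $C=\min_{s,\,t}C_t$ be the static (worst-case) min-cut. Let $t_0$ be the first time by which every node has failed, and let $C_{\rm avg}=\limsup_{l\to\infty}\frac1l\sum_{t=t_0}^l C_t$. **Theorem.** Let the failed nodes $S_1,S_2,\dots$ be independent and uniformly distributed on $V$. Assume that almost surely, for all sets $W\subseteq V$ of $n-k$ nodes, all $t\ge t_0$ and all $D\subseteq\mathcal A_t$ with $|D|=k$,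 $$\sum_{v\in W}\beta(v)\ \ge\ |C_t(D)-C_{\rm avg}| .$$ Then almost surely $$\mathsf{cap}(\mathcal N)\ \ge\ C+\frac{\beta_1-\beta_2}{2}\cdot\frac{a n_1}{n}\Bigl(a+1+\frac{n_1-1}{n-1}(a-1)\Bigr).$$ -/

import Mathlib

open Filter MeasureTheory ProbabilityTheory
open scoped ENNReal NNReal

namespace StorageNetwork

/-- Value of a minimum cut separating the set `A` from the set `B` in the weighted directed graph on
the vertex set `N` whose edge `(x, y)` has weight `c x y` (weight `0` means that there is no edge).
A cut is given by its part `T` containing `B`; its weight is the sum of the weights of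
the edges that lead from the complement of `T` into `T`. -/
noncomputable def minCut {N : Type*} (c : N → N → ℝ≥0∞) (A B : Set N) : ℝ≥0∞ :=
  ⨅ (T : Set N) (_ : B ⊆ T) (_ : Disjoint A T), ∑' x : ↥Tᶜ, ∑' y : ↥T, c x y

/-- Vertices of the information flow graphs. Failures are numbered `0, 1, 2, …`; the failure number
`j` creates the vertices `cu j` (the computing unit performing the repair) and
`repaired j` (the newcomer that replaces the failed node). -/
inductive FlowVertex (V : Type*) where
  | source : FlowVertex V
  | init (v : V) : FlowVertex V
  | cu (j : ℕ) : FlowVertex V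
  | repaired (j : ℕ) : FlowVertex V
  deriving DecidableEq

variable {V : Type*} [DecidableEq V]

/-- The active vertex that represents the storage node `v` after the first `t` failures of the
sequence `s` of failed nodes. -/
def activeVertex (s : ℕ → V) : ℕ → V → FlowVertex V
  | 0, v => FlowVertex.init v
  | t + 1, v => if s t = v then FlowVertex.repaired t else activeVertex s t v

/-- The set of active vertices after the first `t` failures. -/
def activeSet (s : ℕ → V) (t : ℕ) : Set (FlowVertex V) :=
  Set.range (activeVertex s t)

/-- Edge weights of the information flow graph after the first `t` failures. The storage capacity of
a single node is unlimited, so the edges `source → init v` and `cu j → repaired j` have infinite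
weight. At the failure number `j < t` every node `u ≠ s j` sends `h j u` symbols to `cu j`. -/
noncomputable def edgeWeight [Fintype V] (h : ℕ → V → ℝ≥0) (s : ℕ → V) (t : ℕ) :
    FlowVertex V → FlowVertex V → ℝ≥0∞
  | FlowVertex.source, FlowVertex.init _ => ⊤
  | FlowVertex.cu i, FlowVertex.repaired j => if i = j ∧ j < t then ⊤ else 0
  | x, FlowVertex.cu j =>
      ∑ u : V, if j < t ∧ u ≠ s j ∧ activeVertex s j u = x then (h j u : ℝ≥0∞) else 0
  | _, _ => 0

/-- The value of a minimum cut between the source and the nodes of `D`, after `t` failures. -/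
noncomputable def sourceCut [Fintype V] (h : ℕ → V → ℝ≥0) (s : ℕ → V) (t : ℕ) (D : Finset V) :
    ℝ≥0∞ :=
  minCut (edgeWeight h s t) {FlowVertex.source} (activeVertex s t '' (D : Set V))

/-- `cap_h`: the largest file size that can be retrieved at any time from any `k` active nodes,
i.e. the smallest cut between the source and `k` active nodes, over all times. -/
noncomputable def capWith [Fintype V] (k : ℕ) (h : ℕ → V → ℝ≥0) (s : ℕ → V) : ℝ≥0∞ :=
  ⨅ (t : ℕ) (D : Finset V) (_ : D.card = k), sourceCut h s t D

/-- The long-run average number of symbols sent by the node `v` per repair is at most `β v`.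
(The value `h j (s j)` never enters a flow graph, it may be taken to be `0`.) -/
def Admissible (β : V → ℝ≥0) (h : ℕ → V → ℝ≥0) : Prop :=
  ∀ v, limsup (fun l : ℕ => (∑ j ∈ Finset.range l, (h j v : ℝ≥0∞)) / (l : ℝ≥0∞)) atTop ≤ β v

/-- The storage capacity of the network for the sequence `s` of failed nodes. -/
noncomputable def capacity [Fintype V] (β : V → ℝ≥0) (k : ℕ) (s : ℕ → V) : ℝ≥0∞ :=
  ⨆ (h : ℕ → V → ℝ≥0) (_ : Admissible β h), capWith k h s

/-- The weight function `h*`: each helper node `v` always sends `β v` symbols. -/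
def hStar (β : V → ℝ≥0) (s : ℕ → V) (j : ℕ) (v : V) : ℝ≥0 :=
  if s j = v then 0 else β v

/-- `C_t^{h*}(D)`: the value of a minimum cut, after `t` failures and under `h*`, between the set of
all formerly active vertices (including the source) that are no longer active and the nodes
of `D`. -/
noncomputable def cutAt [Fintype V] (β : V → ℝ≥0) (s : ℕ → V) (t : ℕ) (D : Finset V) : ℝ≥0∞ :=
  minCut (edgeWeight (hStar β s) s t)
    (({FlowVertex.source} ∪ ⋃ i < t, activeSet s i) \ activeSet s t)
    (activeVertex s t '' (D : Set V))

/-- `C_t^{h*}`: the minimum of `C_t^{h*}(D)` over all sets `D` of `k` nodes. -/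
noncomputable def minCutAt [Fintype V] (β : V → ℝ≥0) (k : ℕ) (s : ℕ → V) (t : ℕ) : ℝ≥0∞ :=
  ⨅ (D : Finset V) (_ : D.card = k), cutAt β s t D

/-- The static (worst-case) minimum cut `C`. -/
noncomputable def staticMinCut [Fintype V] (β : V → ℝ≥0) (k : ℕ) : ℝ≥0∞ :=
  ⨅ (s : ℕ → V) (t : ℕ), minCutAt β k s t

/-- Every node has failed at least once among the first `t` failures. -/
def AllFailed (s : ℕ → V) (t : ℕ) : Prop :=
  ∀ v, ∃ j, j < t ∧ s j = v

open Classical in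
/-- The average cut `C_avg^{h*}` of the discrete-time network. The average starts when all nodes have
failed at least once: before that cuts may be infinite, as the initial nodes are
joined to the source by edges of infinite weight. -/
noncomputable def avgCut [Fintype V] (β : V → ℝ≥0) (k : ℕ) (s : ℕ → V) : ℝ≥0∞ :=
  limsup (fun l : ℕ =>
    (∑ t ∈ (Finset.Icc 1 l).filter (fun t => AllFailed s t), minCutAt β k s t) / (l : ℝ≥0∞)) atTop

/-- The standing assumption on the network: the bandwidths of any `n - k` nodes add up to at least
`|C_t^{h*}(D) - C_avg^{h*}|`, for each set `D` of `k` nodes and each time `t` by which all nodes have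
failed. The absolute value is spelled out as two inequalities. -/
def BandwidthCondition [Fintype V] (β : V → ℝ≥0) (k : ℕ) (s : ℕ → V) : Prop :=
  ∀ W : Finset V, W.card = Fintype.card V - k → ∀ t, AllFailed s t →
    ∀ D : Finset V, D.card = k →
      cutAt β s t D ≤ avgCut β k s + ∑ v ∈ W, (β v : ℝ≥0∞) ∧
      avgCut β k s ≤ cutAt β s t D + ∑ v ∈ W, (β v : ℝ≥0∞)

/-- The bandwidths of the fixed-cost network on `n₁ + n₂` nodes: `β₁` on the set `U` of the first `n₁`
nodes and `β₂` on the set `L` of the other `n₂` nodes. -/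
def fixedCost (n₁ n₂ : ℕ) (β₁ β₂ : ℝ≥0) (v : Fin (n₁ + n₂)) : ℝ≥0 :=
  if (v : ℕ) < n₁ then β₁ else β₂

end StorageNetwork

/-! Under `hStar` a node sends nothing during its own repair. By the strong law, each node fails
with frequency `1 / n`, so it spends only the fraction `(n - 1) / n` of its bandwidth, and `hStar`
scaled by `n / (n - 1)` is admissible almost surely (`admissible_of_tendsto_frequency`). Every
source cut under `hStar` is at least the static cut `C` (`staticMinCut_le_sourceCut`), so the
capacity is at least `C + C / (n - 1)`.

It remains to bound the claimed gain by `C / (n - 1)`. Minimum cuts reduce to `orderedCut`, a sum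
over ordered pairs of nodes. Comparison with constant bandwidth `β₂` gives `C ≥ β₂ * k * (2 * n - k
- 1) / 2` (`le_staticMinCut`). Almost surely all nodes fail consecutively in increasing order at
some time and in decreasing order at another (`ae_exists_word`). For `D` the first `k` nodes, the
two cuts differ by at least `(β₁ - β₂) * a * n₁`. Both lie within `(n₂ - a) * β₂` of the average
cut, which cancels, so the difference is at most twice this (`BandwidthCondition.mul_le`). The rest
is real arithmetic (`gain_le`). -/

namespace StorageNetwork

/-! ### Minimum cuts as ordered cuts -/

section Cuts

variable {V : Type*}

/-- `j` is the number of the last failure of the node `v` among the first `t` failures. -/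
def IsLastFailure (s : ℕ → V) (t : ℕ) (v : V) (j : ℕ) : Prop :=
  j < t ∧ s j = v ∧ ∀ i, j < i → i < t → s i ≠ v

lemma IsLastFailure.unique {s : ℕ → V} {t : ℕ} {v : V} {i j : ℕ}
    (hi : IsLastFailure s t v i) (hj : IsLastFailure s t v j) : i = j := by
  rcases lt_trichotomy i j with h | h | h
  · exact absurd hj.2.1 (hi.2.2 j h hj.1)
  · exact h
  · exact absurd hi.2.1 (hj.2.2 i h hi.1)

/-- Every order of the nodes of `E` occurs in some sequence of failures. -/
lemma exists_isLastFailure (E : Finset V) (hE : E.Nonempty) (τ : V → ℕ)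
    (hτ : Set.InjOn τ (E : Set V)) :
    ∃ (s : ℕ → V) (t : ℕ), ∀ v ∈ E, IsLastFailure s t v (τ v) := by
  classical
  -- Failure `j` is assigned to the node of `E` with the least `τ`-value not below `j`; thus `v`
  -- fails at `τ v` and at no later index up to the maximum of `τ` on `E`.
  have hex : ∀ j, ∃ w, (∃ v ∈ E, j ≤ τ v) → w ∈ E ∧ j ≤ τ w ∧ ∀ v ∈ E, j ≤ τ v → τ w ≤ τ v := by
    intro j
    by_cases h : ∃ v ∈ E, j ≤ τ v
    · obtain ⟨v, hv, hj⟩ := h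
      obtain ⟨w, hw, hmin⟩ := (E.filter fun v => j ≤ τ v).exists_min_image τ
        ⟨v, Finset.mem_filter.mpr ⟨hv, hj⟩⟩
      rw [Finset.mem_filter] at hw
      exact ⟨w, fun _ => ⟨hw.1, hw.2, fun x hx hjx => hmin x (Finset.mem_filter.mpr ⟨hx, hjx⟩)⟩⟩
    · exact ⟨hE.choose, fun h' => absurd h' h⟩
  choose s hs using hex
  obtain ⟨m, hm, hmax⟩ := E.exists_max_image τ hE
  refine ⟨s, τ m + 1, fun v hv => ⟨Nat.lt_succ_of_le (hmax v hv), ?_, fun i h1 h2 heq => ?_⟩⟩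
  · obtain ⟨h1, h2, h3⟩ := hs (τ v) ⟨v, hv, le_rfl⟩
    exact hτ h1 hv (le_antisymm (h3 v hv le_rfl) h2)
  · obtain ⟨-, h4, -⟩ := hs i ⟨m, hm, by omega⟩
    rw [heq] at h4
    omega

variable [DecidableEq V]

lemma IsLastFailure.activeVertex_eq {s : ℕ → V} {t : ℕ} {v : V} {j : ℕ}
    (h : IsLastFailure s t v j) : activeVertex s t v = FlowVertex.repaired j := by
  induction t with
  | zero => exact absurd h.1 (by omega)
  | succ t ih =>
    obtain ⟨hj, hv, hlast⟩ := h
    by_cases hjt : j = t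
    · subst hjt
      simp [activeVertex, hv]
    · have hne : s t ≠ v := hlast t (by omega) (by omega)
      simp only [activeVertex, hne, if_false]
      exact ih ⟨by omega, hv, fun i h1 h2 => hlast i h1 (by omega)⟩

/-- An active vertex is either initial or was created by the last failure of its node. -/
lemma activeVertex_cases (s : ℕ → V) (t : ℕ) (v : V) :
    activeVertex s t v = FlowVertex.init v ∨
      ∃ j, IsLastFailure s t v j ∧ activeVertex s t v = FlowVertex.repaired j := by
  induction t with
  | zero => exact Or.inl rfl
  | succ t ih =>
    by_cases hv : s t = v
    · have h : IsLastFailure s (t + 1) v t := ⟨by omega, hv, fun i h1 h2 => by omega⟩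
      exact Or.inr ⟨t, h, h.activeVertex_eq⟩
    · rcases ih with h | ⟨j, hj, -⟩
      · exact Or.inl (by simp [activeVertex, hv, h])
      · have h : IsLastFailure s (t + 1) v j :=
          ⟨by have := hj.1; omega, hj.2.1, fun i h1 h2 => by
            rcases Nat.lt_succ_iff_lt_or_eq.mp h2 with h3 | h3
            · exact hj.2.2 i h1 h3
            · exact h3 ▸ hv⟩
        exact Or.inr ⟨j, h, h.activeVertex_eq⟩

variable [Fintype V]

lemma edgeWeight_cu (h : ℕ → V → ℝ≥0) (s : ℕ → V) (t : ℕ) (x : FlowVertex V) (j : ℕ) :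
    edgeWeight h s t x (FlowVertex.cu j) =
      ∑ u : V, if j < t ∧ u ≠ s j ∧ activeVertex s j u = x then (h j u : ℝ≥0∞) else 0 := by
  cases x <;> rfl

open Classical in
lemma tsum_edgeWeight_cu (h : ℕ → V → ℝ≥0) (s : ℕ → V) (t : ℕ) (A : Set (FlowVertex V)) (j : ℕ) :
    ∑' x : A, edgeWeight h s t x (FlowVertex.cu j) =
      ∑ u : V, if j < t ∧ u ≠ s j ∧ activeVertex s j u ∈ A then (h j u : ℝ≥0∞) else 0 := by
  simp_rw [edgeWeight_cu]
  rw [Summable.tsum_finsetSum (fun _ _ => ENNReal.summable)]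
  refine Finset.sum_congr rfl fun u _ => ?_
  by_cases hu : activeVertex s j u ∈ A
  · rw [tsum_eq_single (⟨activeVertex s j u, hu⟩ : A)]
    · simp [hu]
    · intro x hx
      rw [if_neg]
      rintro ⟨-, -, h3⟩
      exact hx (Subtype.ext h3.symm)
  · rw [if_neg (by tauto)]
    refine ENNReal.tsum_eq_zero.mpr fun x => ?_
    rw [if_neg]
    rintro ⟨-, -, h3⟩
    exact hu (h3 ▸ x.2)

/-- Value of the cut formed by the nodes of `E` that were repaired in the order given by `τ`:
each of them receives data from all other nodes, except for the members of `E` repaired before. -/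
noncomputable def orderedCut (β : V → ℝ≥0) (E : Finset V) (τ : V → ℕ) : ℝ≥0∞ :=
  ∑ v ∈ E, ∑ u : V, if u ≠ v ∧ (u ∉ E ∨ τ v < τ u) then (β u : ℝ≥0∞) else 0

/-- The value of a cut that separates the source from the nodes of `D` is at least an ordered cut. The
node `v` takes part in it if one of its copies belongs to `T`, and its order is given by the first
such copy. -/
lemma exists_orderedCut_le (β : V → ℝ≥0) (s : ℕ → V) (t : ℕ) (D : Finset V)
    (T : Set (FlowVertex V)) (hsource : FlowVertex.source ∉ T)
    (hD : activeVertex s t '' (D : Set V) ⊆ T)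
    (hfin : ∑' x : ↥Tᶜ, ∑' y : ↥T, edgeWeight (hStar β s) s t x y ≠ ⊤) :
    ∃ (E : Finset V) (τ : V → ℕ), D ⊆ E ∧
      (∀ v ∈ E, τ v < t ∧ s (τ v) = v ∧ FlowVertex.repaired (τ v) ∈ T) ∧
      orderedCut β E τ ≤ ∑' x : ↥Tᶜ, ∑' y : ↥T, edgeWeight (hStar β s) s t x y := by
  classical
  have hedge : ∀ x ∉ T, ∀ y ∈ T, edgeWeight (hStar β s) s t x y ≠ ⊤ := by
    intro x hx y hy htop
    refine hfin (top_le_iff.mp ?_)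
    calc ⊤ = edgeWeight (hStar β s) s t x y := htop.symm
      _ ≤ ∑' y : ↥T, edgeWeight (hStar β s) s t x y :=
        ENNReal.le_tsum (f := fun y : ↥T => edgeWeight (hStar β s) s t x y) ⟨y, hy⟩
      _ ≤ _ := ENNReal.le_tsum
        (f := fun x : ↥Tᶜ => ∑' y : ↥T, edgeWeight (hStar β s) s t x y) ⟨x, hx⟩
  have hinit : ∀ v, FlowVertex.init v ∉ T := fun v hv =>
    hedge _ hsource _ hv rfl
  have hcu : ∀ j < t, FlowVertex.repaired j ∈ T → FlowVertex.cu j ∈ T := by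
    intro j hj hr
    by_contra hc
    exact hedge _ hc _ hr (by simp [edgeWeight, hj])
  let E : Finset V :=
    Finset.univ.filter fun v => ∃ j, j < t ∧ s j = v ∧ FlowVertex.repaired j ∈ T
  have hE : ∀ v ∈ E, ∃ j, j < t ∧ s j = v ∧ FlowVertex.repaired j ∈ T := fun v hv =>
    (Finset.mem_filter.mp hv).2
  let τ : V → ℕ := fun v =>
    if h : ∃ j, j < t ∧ s j = v ∧ FlowVertex.repaired j ∈ T then Nat.find h else 0
  have hτ : ∀ v ∈ E, τ v < t ∧ s (τ v) = v ∧ FlowVertex.repaired (τ v) ∈ T := by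
    intro v hv
    simp only [τ, dif_pos (hE v hv)]
    exact Nat.find_spec (hE v hv)
  have hmin : ∀ v j, j < t → s j = v → FlowVertex.repaired j ∈ T → v ∈ E ∧ τ v ≤ j := by
    intro v j hj hs hr
    have h : ∃ j, j < t ∧ s j = v ∧ FlowVertex.repaired j ∈ T := ⟨j, hj, hs, hr⟩
    refine ⟨Finset.mem_filter.mpr ⟨Finset.mem_univ _, h⟩, ?_⟩
    simp only [τ, dif_pos h]
    exact Nat.find_min' h ⟨hj, hs, hr⟩
  refine ⟨E, τ, ?_, hτ, ?_⟩
  · intro v hv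
    have hmem : activeVertex s t v ∈ T := hD ⟨v, hv, rfl⟩
    rcases activeVertex_cases s t v with h | ⟨j, hj, h⟩
    · exact absurd (h ▸ hmem) (hinit v)
    · exact (hmin v j hj.1 hj.2.1 (h ▸ hmem)).1
  · rw [ENNReal.tsum_comm]
    let e : E → T := fun v =>
      ⟨FlowVertex.cu (τ v), hcu _ (hτ v v.2).1 (hτ v v.2).2.2⟩
    have he : Function.Injective e := by
      intro v w hvw
      have h : τ v = τ w := by
        have := congrArg Subtype.val hvw
        simpa [e] using this
      apply Subtype.ext
      rw [← (hτ v v.2).2.1, ← (hτ w w.2).2.1, h]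
    calc orderedCut β E τ
        ≤ ∑ v ∈ E, ∑' x : ↥Tᶜ, edgeWeight (hStar β s) s t x (FlowVertex.cu (τ v)) := by
          refine Finset.sum_le_sum fun v hv => ?_
          rw [tsum_edgeWeight_cu]
          refine Finset.sum_le_sum fun u _ => ?_
          obtain ⟨hv1, hv2, hv3⟩ := hτ v hv
          by_cases hu : u ≠ v ∧ (u ∉ E ∨ τ v < τ u)
          · have hT : activeVertex s (τ v) u ∈ Tᶜ := by
              intro hmem
              rcases activeVertex_cases s (τ v) u with h | ⟨i, hi, h⟩
              · exact hinit u (h ▸ hmem)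
              · obtain ⟨h1, h2⟩ := hmin u i (hi.1.trans hv1) hi.2.1 (h ▸ hmem)
                have := hi.1
                rcases hu.2 with h3 | h3
                · exact h3 h1
                · omega
            rw [if_pos hu, if_pos ⟨hv1, by rw [hv2]; exact hu.1, hT⟩, hStar, if_neg]
            rw [hv2]
            exact hu.1.symm
          · rw [if_neg hu]
            exact zero_le
      _ = ∑ v : E, ∑' x : ↥Tᶜ, edgeWeight (hStar β s) s t x (e v) :=
          (Finset.sum_coe_sort E
            fun v => ∑' x : ↥Tᶜ, edgeWeight (hStar β s) s t x (FlowVertex.cu (τ v))).symm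
      _ = ∑' v : E, ∑' x : ↥Tᶜ, edgeWeight (hStar β s) s t x (e v) := (tsum_fintype _).symm
      _ ≤ ∑' y : ↥T, ∑' x : ↥Tᶜ, edgeWeight (hStar β s) s t x y :=
          ENNReal.tsum_comp_le_tsum_of_injective he
            fun y : ↥T => ∑' x : ↥Tᶜ, edgeWeight (hStar β s) s t x y

/-- The source side contains all obsolete copies, so a repaired copy in `T` must still be active.
Hence the first copy of a node in `T` is also its last, and only orders of last failures matter. -/
lemma le_cutAt (β : V → ℝ≥0) (s : ℕ → V) (t : ℕ) (D : Finset V) (c : ℝ≥0∞)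
    (hc : ∀ (E : Finset V) (τ : V → ℕ), D ⊆ E → (∀ v ∈ E, IsLastFailure s t v (τ v)) →
      c ≤ orderedCut β E τ) :
    c ≤ cutAt β s t D := by
  refine le_iInf fun T => le_iInf fun hD => le_iInf fun hA => ?_
  by_cases hfin : ∑' x : ↥Tᶜ, ∑' y : ↥T, edgeWeight (hStar β s) s t x y = ⊤
  · rw [hfin]
    exact le_top
  have hsource : FlowVertex.source ∉ T := by
    refine Set.disjoint_left.mp hA ⟨Or.inl rfl, ?_⟩
    rintro ⟨v, hv⟩
    rcases activeVertex_cases s t v with h | ⟨j, -, h⟩ <;> rw [h] at hv <;> cases hv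
  obtain ⟨E, τ, hDE, hτ, hle⟩ := exists_orderedCut_le β s t D T hsource hD hfin
  refine (hc E τ hDE fun v hv => ?_).trans hle
  obtain ⟨h1, h2, h3⟩ := hτ v hv
  have hex : ∃ j, IsLastFailure s (τ v + 1) v j ∧ j = τ v :=
    ⟨τ v, ⟨by omega, h2, fun i _ _ => by omega⟩, rfl⟩
  obtain ⟨j, hj, rfl⟩ := hex
  -- The copy is active at time `τ v + 1`. If that time is `t` the claim is immediate; otherwise an
  -- inactive copy would belong to the forbidden set.
  have hact : FlowVertex.repaired (τ v) ∈ activeSet s t := by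
    by_contra hnot
    refine Set.disjoint_left.mp hA ⟨Or.inr ?_, hnot⟩ h3
    refine Set.mem_iUnion₂.mpr ⟨τ v + 1, ?_, v, hj.activeVertex_eq⟩
    refine lt_of_le_of_ne h1 fun heq => hnot ?_
    exact heq ▸ ⟨v, hj.activeVertex_eq⟩
  obtain ⟨w, hw⟩ := hact
  rcases activeVertex_cases s t w with h | ⟨i, hi, h⟩
  · rw [h] at hw
    cases hw
  · rw [h] at hw
    cases hw
    have : w = v := hi.2.1.symm.trans h2
    exact this ▸ hi

/-- The cut is realized by taking as `T` the current copies of the members of `E` together with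
their computing units: the infinite edges stay inside `T`, and so do transmissions from members
repaired earlier. -/
lemma cutAt_le_orderedCut (β : V → ℝ≥0) (s : ℕ → V) (t : ℕ) (D E : Finset V) (τ : V → ℕ)
    (hDE : D ⊆ E) (hτ : ∀ v ∈ E, IsLastFailure s t v (τ v)) :
    cutAt β s t D ≤ orderedCut β E τ := by
  classical
  let T : Finset (FlowVertex V) :=
    E.image (fun v => FlowVertex.cu (τ v)) ∪ E.image (fun v => FlowVertex.repaired (τ v))
  have hcuT : ∀ v ∈ E, FlowVertex.cu (τ v) ∈ T := fun v hv =>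
    Finset.mem_union_left _ (Finset.mem_image_of_mem _ hv)
  have hrepT : ∀ v ∈ E, FlowVertex.repaired (τ v) ∈ T := fun v hv =>
    Finset.mem_union_right _ (Finset.mem_image_of_mem _ hv)
  have hinj : ∀ v ∈ E, ∀ w ∈ E, τ v = τ w → v = w := fun v hv w hw h => by
    rw [← (hτ v hv).2.1, ← (hτ w hw).2.1, h]
  have hD : activeVertex s t '' (D : Set V) ⊆ (T : Set (FlowVertex V)) := by
    rintro _ ⟨v, hv, rfl⟩
    rw [(hτ v (hDE hv)).activeVertex_eq]
    exact hrepT v (hDE hv)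
  have hA : Disjoint (({FlowVertex.source} ∪ ⋃ i < t, activeSet s i) \ activeSet s t)
      (T : Set (FlowVertex V)) := by
    refine Set.disjoint_right.mpr fun y hy hyA => ?_
    rcases Finset.mem_union.mp (Finset.mem_coe.mp hy) with h | h
    · obtain ⟨v, -, rfl⟩ := Finset.mem_image.mp h
      rcases hyA.1 with h1 | h1
      · cases h1
      · obtain ⟨i, -, w, hw⟩ := Set.mem_iUnion₂.mp h1
        rcases activeVertex_cases s i w with h2 | ⟨j, -, h2⟩ <;> rw [h2] at hw <;> cases hw
    · obtain ⟨v, hv, rfl⟩ := Finset.mem_image.mp h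
      exact hyA.2 ⟨v, (hτ v hv).activeVertex_eq⟩
  refine (iInf_le_of_le (T : Set (FlowVertex V)) (iInf₂_le_of_le hD hA le_rfl)).trans ?_
  rw [ENNReal.tsum_comm]
  let g : FlowVertex V → ℝ≥0∞ := fun y =>
    ∑' x : ↥(T : Set (FlowVertex V))ᶜ, edgeWeight (hStar β s) s t x y
  have hg : ∑' y : ↥(T : Set (FlowVertex V)), g y = ∑ y ∈ T, g y := Finset.tsum_subtype' T g
  change ∑' y : ↥(T : Set (FlowVertex V)), g y ≤ _
  rw [hg]
  calc ∑ y ∈ T, g y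
      ≤ ∑ y ∈ E.image (fun v => FlowVertex.cu (τ v)), g y
        + ∑ y ∈ E.image (fun v => FlowVertex.repaired (τ v)), g y := by
        rw [← Finset.sum_union_inter]
        exact le_self_add
    _ = ∑ v ∈ E, g (FlowVertex.cu (τ v)) + ∑ v ∈ E, g (FlowVertex.repaired (τ v)) := by
        rw [Finset.sum_image fun v hv w hw h => hinj v hv w hw (by simpa using h),
          Finset.sum_image fun v hv w hw h => hinj v hv w hw (by simpa using h)]
    _ = ∑ v ∈ E, g (FlowVertex.cu (τ v)) := by
        refine (congrArg _ ?_).trans (add_zero _)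
        refine Finset.sum_eq_zero fun v hv => ENNReal.tsum_eq_zero.mpr fun x => ?_
        obtain ⟨x, hx⟩ := x
        cases x with
        | cu i =>
          have : i ≠ τ v := by
            rintro rfl
            exact hx (hcuT v hv)
          simp [edgeWeight, this]
        | _ => rfl
    _ ≤ orderedCut β E τ := by
        refine Finset.sum_le_sum fun v hv => ?_
        simp only [g]
        rw [tsum_edgeWeight_cu]
        refine Finset.sum_le_sum fun u _ => ?_
        obtain ⟨hv1, hv2, hv3⟩ := hτ v hv
        split_ifs with h1 h2 h2
        · refine ENNReal.coe_le_coe.mpr ?_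
          unfold hStar
          split_ifs
          · exact zero_le
          · exact le_rfl
        · obtain ⟨-, hne, hT⟩ := h1
          rw [hv2] at hne
          exfalso
          push Not at h2
          obtain ⟨huE, hle⟩ := h2 hne
          have hlt : τ u < τ v := lt_of_le_of_ne hle fun h => hne (hinj u huE v hv h)
          have hlast : IsLastFailure s (τ v) u (τ u) :=
            ⟨hlt, (hτ u huE).2.1, fun i h3 h4 => (hτ u huE).2.2 i h3 (h4.trans hv1)⟩
          rw [hlast.activeVertex_eq] at hT
          exact hT (hrepT u huE)
        · exact zero_le
        · exact le_rfl

lemma staticMinCut_le_cutAt (β : V → ℝ≥0) (k : ℕ) (s : ℕ → V) (t : ℕ) (D : Finset V)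
    (hD : D.card = k) : staticMinCut β k ≤ cutAt β s t D := by
  unfold staticMinCut minCutAt
  exact iInf_le_of_le s (iInf_le_of_le t (iInf_le_of_le D (iInf_le_of_le hD le_rfl)))

/-- A source cut may use obsolete copies, so its order need not consist of last failures in `s`.
Another failure sequence realizes that order by last failures, and the static cut ranges over all
sequences. -/
lemma staticMinCut_le_sourceCut (β : V → ℝ≥0) (k : ℕ) (hk : 0 < k) (s : ℕ → V) (t : ℕ)
    (D : Finset V) (hD : D.card = k) : staticMinCut β k ≤ sourceCut (hStar β s) s t D := by
  have hne : D.Nonempty := Finset.card_pos.mp (hD ▸ hk)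
  refine le_iInf fun T => le_iInf fun hDT => le_iInf fun hA => ?_
  by_cases hfin : ∑' x : ↥Tᶜ, ∑' y : ↥T, edgeWeight (hStar β s) s t x y = ⊤
  · rw [hfin]
    exact le_top
  obtain ⟨E, τ, hDE, hτ, hle⟩ := exists_orderedCut_le β s t D T
    (Set.disjoint_left.mp hA rfl) hDT hfin
  refine le_trans ?_ hle
  obtain ⟨s', t', hlast⟩ := exists_isLastFailure E (hne.mono hDE) τ fun v hv w hw h => by
    rw [← (hτ v hv).2.1, ← (hτ w hw).2.1, h]
  exact (staticMinCut_le_cutAt β k s' t' D hD).trans (cutAt_le_orderedCut β s' t' D E τ hDE hlast)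

/-- Scaling the transmissions scales every cut; `c ≠ 0` keeps the infinite edges infinite. -/
lemma mul_sourceCut_le (c : ℝ≥0) (hc : c ≠ 0) (h : ℕ → V → ℝ≥0) (s : ℕ → V) (t : ℕ)
    (D : Finset V) : c * sourceCut h s t D ≤ sourceCut (fun j v => c * h j v) s t D := by
  have hedge : ∀ x y, edgeWeight (fun j v => c * h j v) s t x y = c * edgeWeight h s t x y := by
    intro x y
    have hc' : (c : ℝ≥0∞) * ⊤ = ⊤ := ENNReal.mul_top (by exact_mod_cast hc)
    cases y with
    | cu j => simp [edgeWeight_cu, Finset.mul_sum, mul_ite]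
    | _ => cases x <;> simp [edgeWeight, hc', mul_ite]
  refine le_iInf fun T => le_iInf fun hDT => le_iInf fun hA => ?_
  simp_rw [hedge, ENNReal.tsum_mul_left]
  gcongr
  exact iInf_le_of_le T (iInf₂_le_of_le hDT hA le_rfl)

lemma mul_staticMinCut_le_capWith (β : V → ℝ≥0) (k : ℕ) (hk : 0 < k) (c : ℝ≥0) (hc : c ≠ 0)
    (s : ℕ → V) : c * staticMinCut β k ≤ capWith k (fun j v => c * hStar β s j v) s := by
  refine le_iInf fun t => le_iInf fun D => le_iInf fun hD => ?_
  refine le_trans ?_ (mul_sourceCut_le c hc _ s t D)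
  gcongr
  exact staticMinCut_le_sourceCut β k hk s t D hD

end Cuts

/-! ### Counting transmissions in an ordered cut -/

section Counting

variable {V : Type*}

/-- Adding the same count for the reversed order counts every ordered pair of distinct elements
exactly once. -/
lemma two_mul_sum_card_lt (A : Finset V) (τ : V → ℕ) (hτ : Set.InjOn τ (A : Set V)) :
    2 * ∑ v ∈ A, (A.filter fun u => τ v < τ u).card = A.card * (A.card - 1) := by
  classical
  have hswap : ∑ v ∈ A, (A.filter fun u => τ v < τ u).card
      = ∑ v ∈ A, (A.filter fun u => τ u < τ v).card :=
    Finset.sum_card_bipartiteAbove_eq_sum_card_bipartiteBelow (fun v u => τ v < τ u)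
  rw [two_mul]
  nth_rewrite 2 [hswap]
  rw [← Finset.sum_add_distrib, Finset.sum_const_nat]
  intro v hv
  rw [← Finset.card_erase_of_mem hv, ← Finset.card_union_of_disjoint]
  · congr 1
    ext u
    simp only [Finset.mem_union, Finset.mem_filter, Finset.mem_erase]
    constructor
    · rintro (⟨h1, h2⟩ | ⟨h1, h2⟩) <;> refine ⟨?_, h1⟩ <;> rintro rfl <;> omega
    · rintro ⟨h1, h2⟩
      rcases lt_trichotomy (τ v) (τ u) with h | h | h
      · exact Or.inl ⟨h2, h⟩
      · exact absurd (hτ hv h2 h).symm h1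
      · exact Or.inr ⟨h2, h⟩
  · exact Finset.disjoint_filter.mpr fun u _ h1 h2 => by omega

variable [DecidableEq V]

/-- Number of the transmissions counted by an ordered cut whose sender belongs to `A`. -/
def pairCount (E : Finset V) (τ : V → ℕ) (A : Finset V) : ℕ :=
  ∑ v ∈ E, (A.filter fun u => u ≠ v ∧ (u ∉ E ∨ τ v < τ u)).card

/-- Splitting the bandwidth into a base `b` and a surplus `e` on `A` separates the part depending
only on `E.card` from the part sensitive to the repair order. -/
lemma orderedCut_eq [Fintype V] (β : V → ℝ≥0) (b e : ℝ≥0) (A : Finset V)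
    (hβ : ∀ v, β v = b + if v ∈ A then e else 0) (E : Finset V) (τ : V → ℕ) :
    orderedCut β E τ = ((b * pairCount E τ Finset.univ + e * pairCount E τ A : ℝ≥0) : ℝ≥0∞) := by
  have hinner : ∀ v, (∑ u : V, if u ≠ v ∧ (u ∉ E ∨ τ v < τ u) then (β u : ℝ≥0∞) else 0)
      = ((b * (Finset.univ.filter fun u => u ≠ v ∧ (u ∉ E ∨ τ v < τ u)).card
        + e * (A.filter fun u => u ≠ v ∧ (u ∉ E ∨ τ v < τ u)).card : ℝ≥0) : ℝ≥0∞) := by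
    intro v
    rw [← Finset.sum_filter, ← ENNReal.ofNNReal_finsetSum]
    congr 1
    simp_rw [hβ]
    rw [Finset.sum_add_distrib, Finset.sum_const, nsmul_eq_mul, mul_comm b, ← Finset.sum_filter,
      Finset.sum_const, nsmul_eq_mul, mul_comm e]
    congr 4
    ext u
    simp [and_comm]
  unfold orderedCut pairCount
  simp_rw [hinner]
  rw [← ENNReal.ofNNReal_finsetSum, Finset.sum_add_distrib, ← Finset.mul_sum, ← Finset.mul_sum]
  push_cast
  rfl

lemma two_mul_pairCount_univ [Fintype V] (E : Finset V) (τ : V → ℕ)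
    (hτ : Set.InjOn τ (E : Set V)) :
    2 * pairCount E τ Finset.univ + E.card * (E.card + 1) = 2 * (Fintype.card V * E.card) := by
  have hcard : ∀ v ∈ E, (Finset.univ.filter fun u => u ≠ v ∧ (u ∉ E ∨ τ v < τ u)).card
      = Eᶜ.card + (E.filter fun u => τ v < τ u).card := by
    intro v hv
    rw [← Finset.card_union_of_disjoint]
    · congr 1
      ext u
      simp only [Finset.mem_union, Finset.mem_filter, Finset.mem_compl, Finset.mem_univ, true_and]
      constructor
      · rintro ⟨h1, h2⟩
        tauto
      · rintro (h | ⟨h1, h2⟩)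
        · exact ⟨fun h' => h (h' ▸ hv), Or.inl h⟩
        · exact ⟨fun h' => by subst h'; omega, Or.inr h2⟩
    · exact Finset.disjoint_left.mpr fun u h1 h2 =>
        Finset.mem_compl.mp h1 (Finset.mem_filter.mp h2).1
  have hpairs := two_mul_sum_card_lt E τ hτ
  have hcompl := Finset.card_add_card_compl E
  rw [pairCount, Finset.sum_congr rfl hcard, Finset.sum_add_distrib, Finset.sum_const,
    smul_eq_mul, mul_add, hpairs, ← hcompl]
  cases E.card with
  | zero => simp
  | succ m =>
    rw [Nat.add_sub_cancel]
    ring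

/-- The count is `x * n - x * (x + 1) / 2` with `x` the cardinality, which is nondecreasing over the
integers `0 ≤ x ≤ n`. Enlarging `D` to `E` therefore never lowers the base part of a cut. -/
lemma pairCount_univ_mono [Fintype V] (D E : Finset V) (τ τ' : V → ℕ)
    (hτ : Set.InjOn τ (D : Set V)) (hτ' : Set.InjOn τ' (E : Set V)) (hDE : D.card ≤ E.card) :
    pairCount D τ Finset.univ ≤ pairCount E τ' Finset.univ := by
  have h1 := two_mul_pairCount_univ D τ hτ
  have h2 := two_mul_pairCount_univ E τ' hτ'
  have h3 : E.card ≤ Fintype.card V := Finset.card_le_univ E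
  rcases hDE.eq_or_lt with h | h
  · rw [h] at h1
    omega
  · nlinarith

/-- The senders in `A` contribute one transmission for each pair of members of `A`, and one for each
member of `E \ A` that is repaired before a member of `A`. -/
lemma two_mul_pairCount (E A : Finset V) (hAE : A ⊆ E) (τ : V → ℕ)
    (hτ : Set.InjOn τ (E : Set V)) :
    2 * pairCount E τ A = A.card * (A.card - 1)
      + 2 * ∑ v ∈ E \ A, (A.filter fun u => τ v < τ u).card := by
  have hcard : ∀ v ∈ E, (A.filter fun u => u ≠ v ∧ (u ∉ E ∨ τ v < τ u)).card
      = (A.filter fun u => τ v < τ u).card := by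
    intro v hv
    congr 1
    ext u
    simp only [Finset.mem_filter]
    constructor
    · rintro ⟨h1, -, h2 | h2⟩
      · exact absurd (hAE h1) h2
      · exact ⟨h1, h2⟩
    · rintro ⟨h1, h2⟩
      exact ⟨h1, fun h => by subst h; omega, Or.inr h2⟩
  rw [pairCount, Finset.sum_congr rfl hcard, ← Finset.sum_sdiff hAE, mul_add,
    two_mul_sum_card_lt A τ (hτ.mono (by exact_mod_cast hAE)), add_comm]

end Counting

/-! ### Almost sure behaviour of uniform failures -/

section UniformFailures

variable {n : ℕ} {Ω : Type*} [MeasurableSpace Ω] {P : Measure Ω} [IsProbabilityMeasure P]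
  {S : ℕ → Ω → Fin n}

/-- Almost surely each node fails with frequency `1 / n`. -/
lemma ae_tendsto_frequency (hmeas : ∀ j, Measurable (S j)) (hindep : iIndepFun S P)
    (hunif : ∀ j v, P {ω | S j ω = v} = 1 / (n : ℝ≥0∞)) :
    ∀ᵐ ω ∂P, ∀ v, Tendsto
      (fun l : ℕ => (∑ j ∈ Finset.range l, if S j ω = v then (0 : ℝ) else 1) / l) atTop
      (nhds (1 - 1 / n)) := by
  refine ae_all_iff.mpr fun v => ?_
  let f : Fin n → ℝ := fun w => if w = v then 0 else 1
  have hf : Measurable f := measurable_of_finite f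
  have hmap : ∀ j, P.map (S j) = P.map (S 0) := by
    intro j
    refine Measure.ext_of_singleton fun w => ?_
    rw [Measure.map_apply (hmeas j) (measurableSet_singleton w),
      Measure.map_apply (hmeas 0) (measurableSet_singleton w)]
    exact (hunif j w).trans (hunif 0 w).symm
  have hident : ∀ j, IdentDistrib (f ∘ S j) (f ∘ S 0) P P := fun j =>
    IdentDistrib.comp ⟨(hmeas j).aemeasurable, (hmeas 0).aemeasurable, hmap j⟩ hf
  have hint : Integrable (f ∘ S 0) P := by
    refine Integrable.of_bound (hf.comp (hmeas 0)).aestronglyMeasurable 1 (ae_of_all _ fun ω => ?_)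
    simp only [f, Function.comp]
    split_ifs <;> simp
  have hmean : ∫ ω, (f ∘ S 0) ω ∂P = 1 - 1 / (n : ℝ) := by
    have hset : MeasurableSet {ω | S 0 ω = v} := hmeas 0 (measurableSet_singleton v)
    have hind : f ∘ S 0 = {ω | S 0 ω = v}ᶜ.indicator fun _ => (1 : ℝ) := by
      ext ω
      by_cases h : S 0 ω = v <;> simp [f, h]
    rw [hind, integral_indicator_const _ hset.compl, measureReal_compl hset,
      measureReal_def P {ω | S 0 ω = v}, hunif 0 v]
    simp
  have hlaw := strong_law_ae_real (fun j => f ∘ S j) hint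
    (fun i j hij => (hindep.indepFun hij).comp hf hf) hident
  rw [hmean] at hlaw
  exact hlaw

/-- Almost surely every finite word occurs in the sequence of failures. -/
lemma ae_exists_word (hmeas : ∀ j, Measurable (S j)) (hindep : iIndepFun S P)
    (hunif : ∀ j v, P {ω | S j ω = v} = 1 / (n : ℝ≥0∞)) (m : ℕ) (hm : 0 < m) (w : ℕ → Fin n) :
    ∀ᵐ ω ∂P, ∃ t, ∀ i < m, S (t + i) ω = w i := by
  -- Disjoint blocks of length `m` give independent events of equal positive probability, so the
  -- second Borel–Cantelli lemma applies.
  let A : ℕ → Set Ω := fun b => ⋂ i ∈ Finset.range m, {ω | S (b * m + i) ω = w i}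
  have hset : ∀ j v, MeasurableSet {ω | S j ω = v} := fun j v =>
    hmeas j (measurableSet_singleton v)
  have hA : ∀ b, MeasurableSet (A b) := fun b =>
    Finset.measurableSet_biInter _ fun i _ => hset _ _
  have hmul : ∀ (J : Finset ℕ) (v : ℕ → Fin n),
      P (⋂ j ∈ J, {ω | S j ω = v j}) = (1 / (n : ℝ≥0∞)) ^ J.card := by
    intro J v
    have := hindep.meas_biInter (S := J) (s := fun j => {ω | S j ω = v j}) fun j _ =>
      ⟨{v j}, measurableSet_singleton _, rfl⟩
    rw [this, Finset.prod_congr rfl fun j _ => hunif j (v j), Finset.prod_const]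
  have hinter : ∀ B : Finset ℕ, P (⋂ b ∈ B, A b) = (1 / (n : ℝ≥0∞)) ^ (B.card * m) := by
    intro B
    let J : Finset ℕ := (B ×ˢ Finset.range m).image fun p => p.1 * m + p.2
    have hdivmod : ∀ b i, i < m → (b * m + i) / m = b ∧ (b * m + i) % m = i := by
      intro b i hi
      constructor
      · rw [mul_comm, Nat.mul_add_div hm, Nat.div_eq_of_lt hi, add_zero]
      · rw [mul_comm, Nat.mul_add_mod, Nat.mod_eq_of_lt hi]
    have hJ : J.card = B.card * m := by
      rw [Finset.card_image_of_injOn, Finset.card_product, Finset.card_range]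
      rintro ⟨b, i⟩ hp ⟨b', i'⟩ hp' heq
      have hi : i < m := by simpa using (Finset.mem_product.mp hp).2
      have hi' : i' < m := by simpa using (Finset.mem_product.mp hp').2
      have heq' : b * m + i = b' * m + i' := heq
      have h1 := hdivmod b i hi
      have h2 := hdivmod b' i' hi'
      rw [heq'] at h1
      exact Prod.ext (h1.1.symm.trans h2.1) (h1.2.symm.trans h2.2)
    rw [← hJ, ← hmul J fun j => w (j % m)]
    congr 1
    ext ω
    simp only [A, J, Set.mem_iInter, Finset.mem_image, Finset.mem_product, Finset.mem_range,
      Set.mem_ofPred_eq]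
    constructor
    · rintro h _ ⟨⟨b, i⟩, ⟨hb, hi⟩, rfl⟩
      rw [(hdivmod b i hi).2]
      exact h b hb i hi
    · intro h b hb i hi
      have := h (b * m + i) ⟨(b, i), ⟨hb, hi⟩, rfl⟩
      rwa [(hdivmod b i hi).2] at this
  have hPA : ∀ b, P (A b) = (1 / (n : ℝ≥0∞)) ^ m := fun b => by
    simpa using hinter {b}
  have hindepA : iIndepSet A P := by
    refine (iIndepSet_iff_meas_biInter hA).mpr fun B => ?_
    rw [hinter B, Finset.prod_congr rfl fun b _ => hPA b, Finset.prod_const, ← pow_mul, mul_comm]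
  have hsum : ∑' b, P (A b) = ⊤ := by
    simp_rw [hPA]
    refine ENNReal.tsum_const_eq_top_of_ne_zero ?_
    exact pow_ne_zero _ (ENNReal.div_ne_zero.mpr ⟨one_ne_zero, ENNReal.natCast_ne_top n⟩)
  have hlim : ∀ᵐ ω ∂P, ω ∈ limsup A atTop := by
    have hms : MeasurableSet (limsup A atTop) := MeasurableSet.measurableSet_limsup hA
    exact (mem_ae_iff_prob_eq_one hms).mpr (measure_limsup_eq_one hA hindepA hsum)
  filter_upwards [hlim] with ω hω
  obtain ⟨b, hb⟩ := (mem_limsup_iff_frequently_mem.mp hω).exists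
  exact ⟨b * m, fun i hi => by simpa using Set.mem_iInter₂.mp hb i (Finset.mem_range.mpr hi)⟩

end UniformFailures

/-- A failed node sends nothing during its own repair, so under `hStar` the node `v` uses only the
fraction `(n - 1) / n` of its average bandwidth; the weights may be enlarged by `n / (n - 1)`. -/
lemma admissible_of_tendsto_frequency {n : ℕ} (hn : 2 ≤ n) (β : Fin n → ℝ≥0) (s : ℕ → Fin n)
    (hs : ∀ v, Tendsto (fun l : ℕ => (∑ j ∈ Finset.range l, if s j = v then (0 : ℝ) else 1) / l)
      atTop (nhds (1 - 1 / n))) :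
    Admissible β fun j v => (n / (n - 1 : ℕ) : ℝ≥0) * hStar β s j v := by
  intro v
  have hn1 : ((n - 1 : ℕ) : ℝ) ≠ 0 := by exact_mod_cast (by omega : n - 1 ≠ 0)
  have hn0 : (n : ℝ) ≠ 0 := by exact_mod_cast (by omega : n ≠ 0)
  have hlim := (hs v).const_mul ((n / (n - 1 : ℕ) : ℝ) * β v)
  have hval : (n / (n - 1 : ℕ) : ℝ) * β v * (1 - 1 / n) = β v := by
    have : ((n - 1 : ℕ) : ℝ) = n - 1 := by push_cast [Nat.cast_sub (by omega : 1 ≤ n)]; ring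
    rw [this] at hn1 ⊢
    field_simp
  rw [hval] at hlim
  have hlim' := (ENNReal.continuous_ofReal.tendsto _).comp hlim
  rw [ENNReal.ofReal_coe_nnreal] at hlim'
  refine le_of_eq (Tendsto.limsup_eq (hlim'.congr' ?_))
  filter_upwards [eventually_gt_atTop 0] with l hl
  have hl0 : (0 : ℝ) < l := by exact_mod_cast hl
  simp only [Function.comp]
  rw [← mul_div_assoc, ENNReal.ofReal_div_of_pos hl0, ENNReal.ofReal_natCast, Finset.mul_sum,
    ENNReal.ofReal_sum_of_nonneg fun j _ => by split_ifs <;> positivity]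
  congr 1
  refine Finset.sum_congr rfl fun j _ => ?_
  rw [← ENNReal.ofReal_coe_nnreal]
  congr 1
  unfold hStar
  split_ifs <;> simp [-Nat.cast_tsub]

/-! ### Consequences of the bandwidth condition -/

section Bandwidth

/-- Since `p` is its own inverse, `v` occupies exactly position `p v` of the word. -/
lemma isLastFailure_of_word {n : ℕ} (s : ℕ → Fin n) (t₀ : ℕ) (p : Fin n → Fin n)
    (hp : Function.Involutive p) (hs : ∀ i (hi : i < n), s (t₀ + i) = p ⟨i, hi⟩) (v : Fin n) :
    IsLastFailure s (t₀ + n) v (t₀ + p v) := by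
  refine ⟨by have := (p v).2; omega, (hs _ (p v).2).trans (hp v), fun i h1 h2 heq => ?_⟩
  obtain ⟨j, rfl⟩ := Nat.exists_eq_add_of_le (show t₀ ≤ i by omega)
  rw [hs j (by omega)] at heq
  have : p v = ⟨j, by omega⟩ := by rw [← heq, hp]
  rw [this] at h1
  simp at h1

variable {n₁ n₂ : ℕ}

/-- The nodes with numbers less than `m`. -/
def initialNodes (n₁ n₂ m : ℕ) : Finset (Fin (n₁ + n₂)) :=
  Finset.univ.filter fun v => (v : ℕ) < m

lemma mem_initialNodes {m : ℕ} {v : Fin (n₁ + n₂)} : v ∈ initialNodes n₁ n₂ m ↔ (v : ℕ) < m := by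
  simp [initialNodes]

lemma card_initialNodes {m : ℕ} (hm : m ≤ n₁ + n₂) : (initialNodes n₁ n₂ m).card = m := by
  have h := Fin.card_filter_val_lt (n := n₁ + n₂) (m := m)
  rw [initialNodes, h, min_eq_right hm]

lemma fixedCost_eq (b e : ℝ≥0) (v : Fin (n₁ + n₂)) :
    fixedCost n₁ n₂ (b + e) b v = b + if v ∈ initialNodes n₁ n₂ n₁ then e else 0 := by
  rw [fixedCost]
  simp only [mem_initialNodes]
  split_ifs <;> simp

/-- Each cut of `k` nodes is at least as large as in a network where all nodes have bandwidth `b`. -/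
lemma le_staticMinCut (b e : ℝ≥0) (k N : ℕ) (hN : 2 * N + k * (k + 1) = 2 * ((n₁ + n₂) * k)) :
    ((b * N : ℝ≥0) : ℝ≥0∞) ≤ staticMinCut (fixedCost n₁ n₂ (b + e) b) k := by
  refine le_iInf₂ fun s t => le_iInf₂ fun D hD => le_cutAt _ s t D _ fun E τ hDE hτ => ?_
  have hinj : Set.InjOn τ (E : Set (Fin (n₁ + n₂))) := fun v hv w hw h => by
    rw [← (hτ v hv).2.1, ← (hτ w hw).2.1, h]
  rw [orderedCut_eq _ b e _ (fixedCost_eq b e)]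
  have hDN := two_mul_pairCount_univ D τ (hinj.mono (by exact_mod_cast hDE))
  have hmono := pairCount_univ_mono D E τ τ (hinj.mono (by exact_mod_cast hDE)) hinj
    (Finset.card_le_card hDE)
  rw [hD, Fintype.card_fin] at hDN
  have hle : N ≤ pairCount E τ Finset.univ := by omega
  refine ENNReal.coe_le_coe.mpr ?_
  calc b * N ≤ b * pairCount E τ Finset.univ := by gcongr
    _ ≤ _ := le_self_add

/-- If all nodes failed both in increasing and in decreasing order, then the bandwidth condition
bounds the difference of the two bandwidths. -/
lemma BandwidthCondition.mul_le {a : ℕ} (ha : a ≤ n₂) {b e : ℝ≥0} {s : ℕ → Fin (n₁ + n₂)}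
    (hcond : BandwidthCondition (fixedCost n₁ n₂ (b + e) b) (n₁ + a) s) {t t' : ℕ}
    (hs : ∀ i (hi : i < n₁ + n₂), s (t + i) = ⟨i, hi⟩)
    (hs' : ∀ i (hi : i < n₁ + n₂), s (t' + i) = Fin.rev ⟨i, hi⟩) :
    e * (a * n₁ : ℕ) ≤ 2 * ((n₂ - a : ℕ) * b) := by
  set U := initialNodes n₁ n₂ n₁ with hU
  set D := initialNodes n₁ n₂ (n₁ + a) with hD
  set W := Finset.univ \ D with hW
  have hUcard : U.card = n₁ := card_initialNodes (by omega)
  have hDcard : D.card = n₁ + a := card_initialNodes (by omega)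
  have hWcard : W.card = Fintype.card (Fin (n₁ + n₂)) - (n₁ + a) := by
    rw [hW, Finset.card_sdiff_of_subset (Finset.subset_univ D), hDcard, Finset.card_univ]
  have hUD : U ⊆ D := fun v hv =>
    mem_initialNodes.mpr ((mem_initialNodes.mp hv).trans_le (by omega))
  have hWsum : ∑ v ∈ W, (fixedCost n₁ n₂ (b + e) b v : ℝ≥0∞) = (((n₂ - a : ℕ) * b : ℝ≥0) : ℝ≥0∞) := by
    have hcost : ∀ v ∈ W, fixedCost n₁ n₂ (b + e) b v = b := by
      intro v hv
      rw [fixedCost, if_neg]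
      intro h
      exact (Finset.mem_sdiff.mp hv).2 (mem_initialNodes.mpr (by omega))
    rw [← ENNReal.ofNNReal_finsetSum, Finset.sum_congr rfl hcost, Finset.sum_const, hWcard,
      nsmul_eq_mul, Fintype.card_fin, show n₁ + n₂ - (n₁ + a) = n₂ - a by omega]
  have hlast := isLastFailure_of_word s t id (fun _ => rfl) hs
  have hlast' := isLastFailure_of_word s t' Fin.rev Fin.rev_involutive hs'
  let τ : Fin (n₁ + n₂) → ℕ := fun v => t + (v : ℕ)
  have hτ : Set.InjOn τ (D : Set (Fin (n₁ + n₂))) := fun v _ w _ h => Fin.ext (by simp only [τ] at h; omega)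
  have hle := (hcond W hWcard (t + (n₁ + n₂)) (fun v => ⟨_, (hlast v).1, (hlast v).2.1⟩) D hDcard).2
  have hle' := (hcond W hWcard (t' + (n₁ + n₂)) (fun v => ⟨_, (hlast' v).1, (hlast' v).2.1⟩) D hDcard).1
  have hupper : cutAt (fixedCost n₁ n₂ (b + e) b) s (t + (n₁ + n₂)) D ≤ orderedCut _ D τ :=
    cutAt_le_orderedCut _ s _ D D τ subset_rfl fun v _ => hlast v
  rw [orderedCut_eq _ b e U (fixedCost_eq b e)] at hupper
  -- In increasing order `U` is repaired before `D \ U`, so only pairs inside `U` contribute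
  -- surplus.
  have hcount : 2 * pairCount D τ U = n₁ * (n₁ - 1) := by
    rw [two_mul_pairCount D U hUD τ hτ, hUcard, Finset.sum_eq_zero, mul_zero, add_zero]
    intro v hv
    rw [Finset.card_eq_zero, Finset.filter_eq_empty_iff]
    intro u hu
    have h1 := mem_initialNodes.mp hu
    have h2 : ¬ (v : ℕ) < n₁ := fun h => (Finset.mem_sdiff.mp hv).2 (mem_initialNodes.mpr h)
    simp only [τ]
    omega
  -- In decreasing order every member of `E \ U`, at least `a` of them, is repaired before `U` and
  -- receives from all `n₁` nodes of `U`.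
  have hlower : ((b * pairCount D τ Finset.univ + e * (pairCount D τ U + a * n₁ : ℕ) : ℝ≥0) : ℝ≥0∞)
      ≤ cutAt (fixedCost n₁ n₂ (b + e) b) s (t' + (n₁ + n₂)) D := by
    refine le_cutAt _ s _ D _ fun E τ' hDE hτ' => ?_
    rw [orderedCut_eq _ b e U (fixedCost_eq b e)]
    have hτval : ∀ v ∈ E, τ' v = t' + Fin.rev v := fun v hv => (hτ' v hv).unique (hlast' v)
    have hinj : Set.InjOn τ' (E : Set (Fin (n₁ + n₂))) := fun v hv w hw h => by
      rw [hτval v hv, hτval w hw] at h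
      exact Fin.rev_injective (Fin.ext (by omega))
    have hcount' : pairCount D τ U + a * n₁ ≤ pairCount E τ' U := by
      have h := two_mul_pairCount E U (hUD.trans hDE) τ' hinj
      have hsum : ∑ v ∈ E \ U, (U.filter fun u => τ' v < τ' u).card = (E \ U).card * n₁ := by
        refine Finset.sum_const_nat fun v hv => ?_
        rw [Finset.filter_true_of_mem, hUcard]
        intro u hu
        rw [hτval v (Finset.mem_sdiff.mp hv).1, hτval u (hDE (hUD hu))]
        have h1 := mem_initialNodes.mp hu
        have h2 : ¬ (v : ℕ) < n₁ := fun h => (Finset.mem_sdiff.mp hv).2 (mem_initialNodes.mpr h)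
        have h3 := v.2
        simp only [Fin.val_rev]
        omega
      have hcard : a ≤ (E \ U).card := by
        rw [Finset.card_sdiff_of_subset (hUD.trans hDE), hUcard]
        have := Finset.card_le_card hDE
        omega
      have := Nat.mul_le_mul_right n₁ hcard
      rw [hsum, hUcard] at h
      omega
    have hmono := pairCount_univ_mono D E τ τ' hτ hinj (Finset.card_le_card hDE)
    refine ENNReal.coe_le_coe.mpr ?_
    gcongr
  rw [hWsum] at hle hle'
  have hchain := hlower.trans (hle'.trans (add_le_add_left (hle.trans
    (add_le_add_left hupper _)) _))
  have hnn : b * pairCount D τ Finset.univ + e * (pairCount D τ U + a * n₁ : ℕ)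
      ≤ b * pairCount D τ Finset.univ + e * pairCount D τ U + (n₂ - a : ℕ) * b
        + (n₂ - a : ℕ) * b := by
    exact_mod_cast hchain
  rw [Nat.cast_add, mul_add, ← add_assoc, add_assoc _ _ ((n₂ - a : ℕ) * b), ← two_mul] at hnn
  exact le_of_add_le_add_left hnn

/-- Under the bound on the difference `e` of the bandwidths, the gain from random failures is at most
the fraction `1 / (n - 1)` of the uniform minimum cut. -/
lemma gain_le {n₁ n₂ a k b e : ℝ} (hn₁ : 2 ≤ n₁) (ha : 1 ≤ a) (hk : k = n₁ + a)
    (hkn : k ≤ n₁ + n₂) (hb : 0 ≤ b) (hgap : e * (a * n₁) ≤ 2 * ((n₂ - a) * b)) :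
    e / 2 * (a * n₁ / (n₁ + n₂)) * (a + 1 + (n₁ - 1) / (n₁ + n₂ - 1) * (a - 1))
      ≤ b * (k * (2 * (n₁ + n₂) - k - 1) / 2) / (n₁ + n₂ - 1) := by
  obtain ⟨n, rfl⟩ : ∃ n, n₂ = n - n₁ := ⟨n₁ + n₂, by ring⟩
  rw [add_sub_cancel] at *
  have hn : 0 < n := by linarith
  have hn' : 0 < n - 1 := by linarith
  set q := a + 1 + (n₁ - 1) / (n - 1) * (a - 1) with hq
  have hq0 : 0 ≤ q := by
    have : 0 ≤ (n₁ - 1) / (n - 1) * (a - 1) :=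
      mul_nonneg (div_nonneg (by linarith) hn'.le) (by linarith)
    linarith
  -- Since `a ≤ n`, the fraction is at most `n₁ - 1`, and `a + 1 + (n₁ - 1) = k`.
  have hqk : q ≤ k := by
    have : (n₁ - 1) / (n - 1) * (a - 1) ≤ n₁ - 1 := by
      rw [div_mul_eq_mul_div, div_le_iff₀ hn']
      exact mul_le_mul_of_nonneg_left (by linarith) (by linarith)
    linarith
  calc e / 2 * (a * n₁ / n) * q = e * (a * n₁) * (q / (2 * n)) := by ring
    _ ≤ 2 * ((n - n₁ - a) * b) * (q / (2 * n)) := by gcongr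
    _ ≤ 2 * ((n - n₁ - a) * b) * (k / (2 * n)) := by
      have : 0 ≤ n - n₁ - a := by linarith
      gcongr
    _ ≤ b * (k * (2 * n - k - 1) / 2) / (n - 1) := by
      rw [← mul_div_assoc, div_le_div_iff₀ (by linarith) hn']
      have h1 : 0 ≤ b * k := mul_nonneg hb (by linarith)
      -- This is `n * (2 * n - k - 1) - 2 * (n - k) * (n - 1)`, the slack left after
      -- cross-multiplying.
      have h2 : 0 ≤ (n - 2) * k + n := by nlinarith
      have h3 := mul_nonneg h1 h2
      subst hk
      nlinarith

end Bandwidth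

end StorageNetwork

/-! ### The capacity bound -/

open StorageNetwork in
theorem mainTheorem1
    (n₁ n₂ k a : ℕ) (hn₁ : 2 ≤ n₁) (hn₂ : 2 ≤ n₂)
    (ha : 0 < a) (hk : k = n₁ + a) (hkn : k ≤ n₁ + n₂)
    (β₁ β₂ : ℝ≥0) (hβ₂ : 0 < β₂) (hβ : β₂ ≤ β₁)
    {Ω : Type*} [MeasurableSpace Ω] (P : Measure Ω) [IsProbabilityMeasure P]
    (S : ℕ → Ω → Fin (n₁ + n₂)) (hmeas : ∀ j, Measurable (S j))
    (hindep : iIndepFun S P)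
    (hunif : ∀ j v, P {ω | S j ω = v} = 1 / ((n₁ + n₂ : ℕ) : ℝ≥0∞))
    (hcond : ∀ᵐ ω ∂P,
      StorageNetwork.BandwidthCondition (StorageNetwork.fixedCost n₁ n₂ β₁ β₂) k (fun j => S j ω)) :
    ∀ᵐ ω ∂P,
      StorageNetwork.staticMinCut (StorageNetwork.fixedCost n₁ n₂ β₁ β₂) k
        + ENNReal.ofReal (((β₁ : ℝ) - β₂) / 2 * ((a : ℝ) * n₁ / ((n₁ : ℝ) + n₂))
            * ((a : ℝ) + 1 + ((n₁ : ℝ) - 1) / ((n₁ : ℝ) + n₂ - 1) * ((a : ℝ) - 1)))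
      ≤ StorageNetwork.capacity (StorageNetwork.fixedCost n₁ n₂ β₁ β₂) k (fun j => S j ω) := by
  obtain ⟨e, rfl⟩ := exists_add_of_le hβ
  have hpos : 0 < n₁ + n₂ := by omega
  let word (p : Fin (n₁ + n₂) → Fin (n₁ + n₂)) (i : ℕ) : Fin (n₁ + n₂) :=
    if hi : i < n₁ + n₂ then p ⟨i, hi⟩ else ⟨0, hpos⟩
  have hword : ∀ p (s : ℕ → Fin (n₁ + n₂)) t, (∀ i < n₁ + n₂, s (t + i) = word p i) →
      ∀ i (hi : i < n₁ + n₂), s (t + i) = p ⟨i, hi⟩ := fun p s t h i hi =>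
    (h i hi).trans (dif_pos hi)
  filter_upwards [hcond, ae_tendsto_frequency hmeas hindep hunif,
    ae_exists_word hmeas hindep hunif _ hpos (word id),
    ae_exists_word hmeas hindep hunif _ hpos (word Fin.rev)] with ω hω hfreq hid hrev
  obtain ⟨t, ht⟩ := hid
  obtain ⟨t', ht'⟩ := hrev
  subst hk
  have hgap := hω.mul_le (by omega) (hword _ (fun j => S j ω) t ht)
    (hword _ (fun j => S j ω) t' ht')
  set C := staticMinCut (fixedCost n₁ n₂ (β₂ + e) β₂) (n₁ + a)
  set m := n₁ + n₂ - 1 with hm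
  have hmR : (m : ℝ) = n₁ + n₂ - 1 := by
    rw [hm, Nat.cast_sub (by omega)]
    push_cast
    ring
  have hm0 : (m : ℝ≥0) ≠ 0 := by exact_mod_cast (by omega : m ≠ 0)
  have hcap : (((n₁ + n₂ : ℕ) / m : ℝ≥0) : ℝ≥0∞) * C
      ≤ capacity (fixedCost n₁ n₂ (β₂ + e) β₂) (n₁ + a) fun j => S j ω :=
    (mul_staticMinCut_le_capWith _ _ (by omega) _
      (div_ne_zero (by exact_mod_cast hpos.ne') hm0) _).trans
      (le_iSup₂_of_le _ (admissible_of_tendsto_frequency (by omega) _ _ hfreq) le_rfl)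
  refine le_trans ?_ hcap
  have hratio : ((n₁ + n₂ : ℕ) / m : ℝ≥0) = 1 + 1 / m := by
    rw [show n₁ + n₂ = m + 1 by omega]
    push_cast
    field_simp
  rw [hratio, ENNReal.coe_add, ENNReal.coe_one, add_mul, one_mul]
  gcongr
  -- `N = k * (n - k) + k * (k - 1) / 2`: the transmissions into a `k`-set from outside, plus one
  -- per inner pair.
  obtain ⟨N, hN⟩ : ∃ N, 2 * N + (n₁ + a) * (n₁ + a + 1) = 2 * ((n₁ + n₂) * (n₁ + a)) := by
    obtain ⟨r, hr⟩ := Nat.exists_eq_add_of_le hkn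
    obtain ⟨c, hc⟩ := Nat.even_mul_pred_self (n₁ + a)
    refine ⟨(n₁ + a) * r + c, ?_⟩
    have hc' : c + c + (n₁ + a) = (n₁ + a) * (n₁ + a) := by
      rw [← hc]
      obtain ⟨d, hd⟩ := Nat.exists_eq_add_of_lt (show 0 < n₁ + a by omega)
      rw [hd]
      simp
      ring
    rw [hr]
    linarith
  refine le_trans ?_ (mul_le_mul_right (le_staticMinCut β₂ e (n₁ + a) N hN) _)
  rw [← ENNReal.coe_mul, ← ENNReal.ofReal_coe_nnreal]
  refine ENNReal.ofReal_le_ofReal ?_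
  have hgapR : (e : ℝ) * (a * n₁) ≤ 2 * ((n₂ - a) * β₂) := by
    have : ((n₂ - a : ℕ) : ℝ) = n₂ - a := Nat.cast_sub (by omega)
    rw [← this]
    exact_mod_cast hgap
  have hmain := gain_le (k := n₁ + a) (by exact_mod_cast hn₁) (by exact_mod_cast ha) rfl
    (by exact_mod_cast hkn) β₂.coe_nonneg hgapR
  have hNR : (N : ℝ) = (n₁ + a) * (2 * (n₁ + n₂) - (n₁ + a) - 1) / 2 := by
    have : (2 * N + (n₁ + a) * (n₁ + a + 1) : ℝ) = 2 * ((n₁ + n₂) * (n₁ + a)) := by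
      exact_mod_cast hN
    linarith
  push_cast
  rw [add_sub_cancel_left, hmR, hNR]
  refine hmain.trans (le_of_eq ?_)
  ring
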